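/- Let $\gamma=\lim_{n\to\infty}\bigl(\sum_{k=1}^{n}\frac1k-\ln n\bigr)$ be the Euler--Mascheroni constant and $\Gamma$ the Gamma function. For every real $x$ with $|x|<\frac12$, the series $\sum_{k=1}^{\infty}(-1)^k\frac{\ln k}{k}\sin(2k\pi x)$ converges (as the limit of its partial sums $\sum_{k=1}^{N}$, $N\to\infty$), and $$\ln\frac{\Gamma\left(\frac12+x\right)}{\Gamma\left(\frac12-x\right)}=-2x\,(\gamma+\ln(2\pi))+\frac{2}{\pi}\sum_{k=1}^{\infty}(-1)^k\,\frac{\ln k}{k}\,\sin(2k\pi x).$$ -/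

import Mathlib

open Filter Topology

/-! This is Kummer's Fourier series. Put `c = γ + log 2π` and `f t = log Γ(t) - log Γ(1-t) +
(2t-1)c`, which is antisymmetric about `1/2`. Its `k`-th sine coefficient on `[0,1]` is `2 log k /
(πk)`: the linear term is chosen to cancel everything but `log k`. Evaluating the series at `1/2 +
x` produces the signs `(-1)^k`.

Two facts carry the proof. Since `f` is only integrable on `[0,1]`, with logarithmic singularities
at the ends, convergence is proved at points of differentiability: dividing `f t - f x` by `exp
(2πi(t-x)) - 1` makes the partial sums telescope, and the Riemann-Lebesgue lemma finishes
(`tendsto_fourier_partial_sum`).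

The coefficients of `log Γ` (`integral_log_Gamma_mul_sin`) come from Euler's approximations
`logGammaSeq`, which converge uniformly on `(0,1]`. Their coefficients reduce to `∫ (1 - cos
(2πku))/u` over `[0,n+1]`, and `γ` enters through harmonic numbers once `1/θ` is compared with
`1/sin θ`. -/

/-! ### Pointwise convergence of Fourier series -/

/-- The Riemann-Lebesgue lemma on a bounded interval. -/
theorem tendsto_intervalIntegral_mul_cexp_cocompact (g : ℝ → ℂ) {a b : ℝ} (hab : a ≤ b) (x : ℝ) :
    Tendsto (fun w : ℝ => ∫ t in a..b, g t * Complex.exp (2 * Real.pi * Complex.I * w * (x - t)))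
      (cocompact ℝ) (𝓝 0) := by
  have h := Real.tendsto_integral_exp_smul_cocompact ((Set.Ioc a b).indicator g)
  rw [tendsto_zero_iff_norm_tendsto_zero] at h ⊢
  refine h.congr fun w => ?_
  have h1 : ∫ t in a..b, g t * Complex.exp (2 * Real.pi * Complex.I * w * (x - t)) =
      Complex.exp ((2 * Real.pi * w * x : ℝ) * Complex.I) *
        ∫ v : ℝ, Real.fourierChar (-(v * w)) • (Set.Ioc a b).indicator g v := by
    rw [intervalIntegral.integral_of_le hab, ← MeasureTheory.integral_indicator measurableSet_Ioc,
      ← MeasureTheory.integral_const_mul]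
    congr 1 with t
    by_cases ht : t ∈ Set.Ioc a b
    · simp only [Set.indicator_of_mem ht, Circle.smul_def, Real.fourierChar_apply, smul_eq_mul]
      rw [← mul_assoc, ← Complex.exp_add, mul_comm]
      congr 2
      push_cast
      ring
    · simp [Set.indicator_of_notMem ht]
  rw [h1, norm_mul, Complex.norm_exp_ofReal_mul_I, one_mul]

theorem integral_cexp_two_pi_int_mul_sub (x : ℝ) {k : ℤ} (hk : k ≠ 0) :
    ∫ t in (0 : ℝ)..1, Complex.exp (2 * Real.pi * Complex.I * (k : ℝ) * (x - t)) = 0 := by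
  have hc : (-(2 * Real.pi * Complex.I * k) : ℂ) ≠ 0 := by
    simp [Real.pi_ne_zero, hk]
  have h1 : ∀ t : ℝ, Complex.exp (2 * Real.pi * Complex.I * (k : ℝ) * (x - t)) =
      Complex.exp (2 * Real.pi * Complex.I * k * x) *
        Complex.exp (-(2 * Real.pi * Complex.I * k) * t) := by
    intro t
    rw [← Complex.exp_add]
    congr 1
    push_cast
    ring
  simp_rw [h1]
  rw [intervalIntegral.integral_const_mul, integral_exp_mul_complex hc]
  have h2 : Complex.exp (-(2 * Real.pi * Complex.I * k) * (1 : ℝ)) = 1 := by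
    rw [Complex.exp_eq_one_iff]
    exact ⟨-k, by push_cast; ring⟩
  rw [h2]
  simp

/-- Near `x`, the function `t ↦ exp (2πi(t - x)) - 1` vanishes only at `t = x` and only to first
order. -/
theorem exists_abs_sub_le_mul_norm_cexp_sub_one {x : ℝ} (hx : x ∈ Set.Ioo (0 : ℝ) 1) :
    ∃ A : ℝ, 0 ≤ A ∧ ∀ t ∈ Set.Icc (0 : ℝ) 1,
      |t - x| ≤ A * ‖Complex.exp (2 * Real.pi * Complex.I * (t - x)) - 1‖ := by
  have hpi := Real.pi_pos
  have hnorm : ∀ t : ℝ, ‖Complex.exp (2 * Real.pi * Complex.I * (t - x)) - 1‖ =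
      2 * |Real.sin (Real.pi * (t - x))| := by
    intro t
    have := Complex.norm_exp_I_mul_ofReal_sub_one (2 * Real.pi * (t - x))
    rw [Real.norm_eq_abs, abs_mul, abs_two] at this
    rw [show Real.pi * (t - x) = 2 * Real.pi * (t - x) / 2 by ring, ← this]
    congr 3
    push_cast
    ring
  -- As `x` is interior, `|t - x| < 1`, so the sine vanishes only at `t = x`, where `sinc` equals 1.
  -- Compactness then gives a positive minimum.
  have hpos : ∀ t ∈ Set.Icc (0 : ℝ) 1, 0 < |Real.sinc (Real.pi * (t - x))| := by
    intro t ht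
    rw [abs_pos]
    by_cases h0 : t - x = 0
    · simp [h0]
    · rw [Real.sinc_of_ne_zero (by positivity)]
      refine div_ne_zero ?_ (by positivity)
      intro hs
      obtain ⟨n, hn⟩ := Real.sin_eq_zero_iff.1 hs
      have hn' : (n : ℝ) = t - x := by
        have : Real.pi * ((n : ℝ) - (t - x)) = 0 := by linarith
        rcases mul_eq_zero.1 this with h | h <;> linarith
      have h1 : ((-1 : ℤ) : ℝ) < n := by push_cast; linarith [ht.1, hx.2]
      have h2 : (n : ℝ) < (1 : ℤ) := by push_cast; linarith [ht.2, hx.1]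
      have : n = 0 := by
        have := Int.cast_lt.1 h1
        have := Int.cast_lt.1 h2
        omega
      exact h0 (by rw [← hn', this]; simp)
  have hcont : ContinuousOn (fun t : ℝ => |Real.sinc (Real.pi * (t - x))|) (Set.Icc 0 1) :=
    (Real.continuous_sinc.comp (by fun_prop)).abs.continuousOn
  obtain ⟨s, hs, hmin⟩ := isCompact_Icc.exists_isMinOn (Set.nonempty_Icc.2 zero_le_one) hcont
  set m := |Real.sinc (Real.pi * (s - x))|
  have hm : 0 < m := hpos s hs
  refine ⟨(2 * Real.pi * m)⁻¹, by positivity, fun t ht => ?_⟩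
  rw [hnorm]
  have hle : m ≤ |Real.sinc (Real.pi * (t - x))| := hmin ht
  by_cases h0 : t - x = 0
  · simp [h0]
  · rw [Real.sinc_of_ne_zero (by positivity), abs_div, abs_mul, abs_of_pos hpi,
      le_div_iff₀ (by positivity)] at hle
    rw [inv_mul_eq_div, le_div_iff₀ (by positivity)]
    nlinarith

/-- The difference quotient of an integrable function which is differentiable at `x`, taken with
respect to `exp (2πi(t - x))`, is integrable. -/
theorem intervalIntegrable_sub_div_cexp_sub_one {f : ℝ → ℂ} {x : ℝ}
    (hf : IntervalIntegrable f MeasureTheory.volume 0 1) (hx : x ∈ Set.Ioo (0 : ℝ) 1)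
    (hd : DifferentiableAt ℝ f x) :
    IntervalIntegrable
      (fun t : ℝ => (f t - f x) / (Complex.exp (2 * Real.pi * Complex.I * (t - x)) - 1))
      MeasureTheory.volume 0 1 := by
  obtain ⟨A, hA, hAle⟩ := exists_abs_sub_le_mul_norm_cexp_sub_one hx
  obtain ⟨C, hC⟩ := hd.hasFDerivAt.isBigO_sub.bound
  obtain ⟨δ, hδ, hball⟩ := Metric.eventually_nhds_iff.1 hC
  have hsub : IntervalIntegrable (fun t => f t - f x) MeasureTheory.volume 0 1 :=
    hf.sub intervalIntegrable_const
  -- The first summand controls the difference quotient within `δ` of `x`, the second farther away.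
  have hbound : IntervalIntegrable (fun t => A * (|C| + ‖f t - f x‖ / δ))
      MeasureTheory.volume 0 1 :=
    (intervalIntegrable_const.add (hsub.norm.div_const δ)).const_mul A
  rw [intervalIntegrable_iff_integrableOn_Ioc_of_le zero_le_one] at hsub hbound ⊢
  refine MeasureTheory.Integrable.mono' hbound ?_ ?_
  · refine hsub.aestronglyMeasurable.aemeasurable.div ?_ |>.aestronglyMeasurable
    exact (Continuous.measurable (by fun_prop)).aemeasurable
  · refine (MeasureTheory.ae_restrict_mem measurableSet_Ioc).mono fun t ht => ?_
    rw [norm_div]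
    set E := ‖Complex.exp (2 * Real.pi * Complex.I * (t - x)) - 1‖
    have hE : |t - x| ≤ A * E := hAle t ⟨ht.1.le, ht.2⟩
    have hE0 : 0 ≤ E := norm_nonneg _
    have hmain : ‖f t - f x‖ ≤ (|C| + ‖f t - f x‖ / δ) * |t - x| := by
      by_cases hlt : dist t x < δ
      · have h1 := hball hlt
        rw [Real.norm_eq_abs] at h1
        have h2 := mul_le_mul_of_nonneg_right (le_abs_self C) (abs_nonneg (t - x))
        have h3 : 0 ≤ ‖f t - f x‖ / δ * |t - x| := by positivity
        linarith
      · rw [Real.dist_eq, not_lt] at hlt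
        have h2 : ‖f t - f x‖ / δ * δ ≤ ‖f t - f x‖ / δ * |t - x| := by gcongr
        rw [div_mul_cancel₀ _ hδ.ne'] at h2
        have h3 : 0 ≤ |C| * |t - x| := by positivity
        linarith
    refine div_le_of_le_mul₀ hE0 (by positivity) (hmain.trans ?_)
    calc (|C| + ‖f t - f x‖ / δ) * |t - x| ≤ (|C| + ‖f t - f x‖ / δ) * (A * E) := by gcongr
      _ = _ := by ring

/-- The symmetric partial sums of the Fourier series of an integrable function converge to the
value of the function at every point of differentiability. -/
theorem tendsto_fourier_partial_sum {f : ℝ → ℂ} {x : ℝ}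
    (hf : IntervalIntegrable f MeasureTheory.volume 0 1) (hx : x ∈ Set.Ioo (0 : ℝ) 1)
    (hd : DifferentiableAt ℝ f x) :
    Tendsto (fun N : ℕ =>
      (∫ t in (0 : ℝ)..1, f t) + ∑ k ∈ Finset.Icc 1 N,
        ((∫ t in (0 : ℝ)..1, f t * Complex.exp (2 * Real.pi * Complex.I * (k : ℝ) * (x - t))) +
          ∫ t in (0 : ℝ)..1,
            f t * Complex.exp (2 * Real.pi * Complex.I * (-k : ℝ) * (x - t))))
      atTop (𝓝 (f x)) := by
  set g : ℝ → ℂ := fun t => (f t - f x) / (Complex.exp (2 * Real.pi * Complex.I * (t - x)) - 1)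
    with hg_def
  have hg : IntervalIntegrable g MeasureTheory.volume 0 1 :=
    intervalIntegrable_sub_div_cexp_sub_one hf hx hd
  set e : ℝ → ℝ → ℂ := fun w t => Complex.exp (2 * Real.pi * Complex.I * w * (x - t)) with he_def
  have he : ∀ w, Continuous (e w) := fun w => by simp only [he_def]; fun_prop
  -- Multiplication by `exp (2πi(t-x))` lowers the frequency `w` by one, so each coefficient of `f -
  -- f x` is a difference of consecutive coefficients of `g`.
  have hfact : ∀ (w t : ℝ), t ∈ Set.Icc (0 : ℝ) 1 →
      f t * e w t = f x * e w t + (g t * e (w - 1) t - g t * e w t) := by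
    intro w t ht
    have h1 : e (w - 1) t = Complex.exp (2 * Real.pi * Complex.I * (t - x)) * e w t := by
      simp only [he_def]
      rw [← Complex.exp_add]
      congr 1
      push_cast
      ring
    have h2 : g t * (Complex.exp (2 * Real.pi * Complex.I * (t - x)) - 1) = f t - f x := by
      by_cases h0 : Complex.exp (2 * Real.pi * Complex.I * (t - x)) - 1 = 0
      · obtain ⟨A, -, hA⟩ := exists_abs_sub_le_mul_norm_cexp_sub_one hx
        have := hA t ht
        rw [h0, norm_zero, mul_zero] at this
        have : t = x := by linarith [abs_eq_zero.1 (le_antisymm this (abs_nonneg _))]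
        rw [h0, this]
        simp
      · exact div_mul_cancel₀ _ h0
    rw [h1]
    linear_combination (-e w t) * h2
  have hge : ∀ w, IntervalIntegrable (fun t => g t * e w t) MeasureTheory.volume 0 1 :=
    fun w => hg.mul_continuousOn (he w).continuousOn
  have hint : ∀ w : ℝ, ∫ t in (0 : ℝ)..1, f t * e w t =
      f x * (∫ t in (0 : ℝ)..1, e w t) +
        ((∫ t in (0 : ℝ)..1, g t * e (w - 1) t) - ∫ t in (0 : ℝ)..1, g t * e w t) := by
    intro w
    rw [← intervalIntegral.integral_const_mul, ← intervalIntegral.integral_sub (hge _) (hge _),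
      ← intervalIntegral.integral_add
        (((he w).intervalIntegrable _ _).const_mul _) ((hge _).sub (hge _))]
    refine intervalIntegral.integral_congr fun t ht => ?_
    rw [Set.uIcc_of_le zero_le_one] at ht
    exact hfact w t ht
  have hz : ∀ k : ℤ, k ≠ 0 → ∫ t in (0 : ℝ)..1, e k t = 0 :=
    fun k hk => integral_cexp_two_pi_int_mul_sub x hk
  -- Summing over frequencies `-N` to `N` telescopes, leaving only the frequencies `-N-1` and `N` of
  -- `g`.
  have hsum : ∀ N : ℕ, (∫ t in (0 : ℝ)..1, f t) + ∑ k ∈ Finset.Icc 1 N,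
        ((∫ t in (0 : ℝ)..1, f t * e k t) + ∫ t in (0 : ℝ)..1, f t * e (-k) t) =
      f x + ((∫ t in (0 : ℝ)..1, g t * e (-N - 1) t) - ∫ t in (0 : ℝ)..1, g t * e N t) := by
    intro N
    induction N with
    | zero =>
      have h0 : ∀ t, e 0 t = 1 := fun t => by simp [he_def]
      have := hint 0
      simp only [h0, mul_one, zero_sub, intervalIntegral.integral_const, sub_zero, one_smul] at this
      simpa [h0] using this
    | succ n ih =>
      rw [Finset.sum_Icc_succ_top (by omega), ← add_assoc, ih, hint, hint]
      have h1 : ∫ t in (0 : ℝ)..1, e ((n + 1 : ℕ) : ℝ) t = 0 := by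
        simpa using hz (n + 1) (by omega)
      have h2 : ∫ t in (0 : ℝ)..1, e (-((n + 1 : ℕ) : ℝ)) t = 0 := by
        simpa using hz (-(n + 1)) (by omega)
      rw [h1, h2]
      have h3 : ((n + 1 : ℕ) : ℝ) - 1 = n := by push_cast; ring
      have h4 : -((n + 1 : ℕ) : ℝ) = -n - 1 := by push_cast; ring
      rw [h3, h4]
      ring
  have hlim : Tendsto (fun N : ℕ => f x + ((∫ t in (0 : ℝ)..1, g t * e (-N - 1) t) -
      ∫ t in (0 : ℝ)..1, g t * e N t)) atTop (𝓝 (f x)) := by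
    have hRL := tendsto_intervalIntegral_mul_cexp_cocompact g zero_le_one x
    have hN : Tendsto (fun N : ℕ => (N : ℝ)) atTop (cocompact ℝ) :=
      tendsto_natCast_atTop_atTop.mono_right atTop_le_cocompact
    have hN' : Tendsto (fun N : ℕ => -(N : ℝ) - 1) atTop (cocompact ℝ) := by
      refine Tendsto.mono_right ?_ atBot_le_cocompact
      exact tendsto_atBot_add_const_right _ _
        (tendsto_neg_atTop_atBot.comp tendsto_natCast_atTop_atTop)
    have := ((hRL.comp hN').sub (hRL.comp hN)).const_add (f x)
    simpa [he_def] using this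
  exact hlim.congr fun N => (hsum N).symm

/-! ### Euler's constant and the cosine integral -/

theorem one_sub_cos_div_eq_sinc (a u : ℝ) :
    (1 - Real.cos (a * u)) / u = a * Real.sinc (a * u / 2) * Real.sin (a * u / 2) := by
  have h : Real.cos (a * u) = 1 - 2 * Real.sin (a * u / 2) ^ 2 := by
    rw [← Real.cos_sq_add_sin_sq (a * u / 2), show a * u = 2 * (a * u / 2) by ring, Real.cos_two_mul]
    ring_nf
    linarith [Real.cos_sq_add_sin_sq (a * u * (1 / 2))]
  by_cases hu : a * u = 0
  · simp [hu]
  · have hu0 : u ≠ 0 := right_ne_zero_of_mul hu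
    have ha0 : a ≠ 0 := left_ne_zero_of_mul hu
    rw [h, Real.sinc_of_ne_zero (by simpa using hu)]
    field_simp
    ring

theorem continuous_one_sub_cos_div (a : ℝ) :
    Continuous fun u : ℝ => (1 - Real.cos (a * u)) / u := by
  simp_rw [one_sub_cos_div_eq_sinc]
  have := Real.continuous_sinc.comp (show Continuous fun u : ℝ => a * u / 2 by fun_prop)
  exact (continuous_const.mul this).mul (by fun_prop)

/-- The primitive is `log tan (θ/2) - log (θ/2)`, written with `sinc` so that it is continuous at 0.
-/
theorem hasDerivAt_log_sinc_half_sub_log_cos_half {θ : ℝ} (hθ : θ ∈ Set.Ioo 0 (Real.pi / 2)) :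
    HasDerivAt (fun s => Real.log (Real.sinc (s / 2)) - Real.log (Real.cos (s / 2)))
      (1 / Real.sin θ - 1 / θ) θ := by
  have hpi := Real.pi_pos
  have hs : 0 < Real.sin (θ / 2) :=
    Real.sin_pos_of_pos_of_lt_pi (by linarith [hθ.1]) (by linarith [hθ.2])
  have hc : 0 < Real.cos (θ / 2) :=
    Real.cos_pos_of_mem_Ioo ⟨by linarith [hθ.1], by linarith [hθ.2]⟩
  have h0 : θ ≠ 0 := hθ.1.ne'
  have hhalf : HasDerivAt (fun s : ℝ => s / 2) (1 / 2) θ := (hasDerivAt_id θ).div_const 2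
  have h1 := ((hhalf.sin.log hs.ne').sub (hhalf.log (by positivity))).sub (hhalf.cos.log hc.ne')
  refine (h1.congr_of_eventuallyEq ?_).congr_deriv ?_
  · filter_upwards [Ioo_mem_nhds hθ.1 hθ.2] with s hs
    have hs' : 0 < Real.sin (s / 2) :=
      Real.sin_pos_of_pos_of_lt_pi (by linarith [hs.1]) (by linarith [hs.2])
    have : s / 2 ≠ 0 := by linarith [hs.1] |> fun h : 0 < s / 2 => h.ne'
    simp only [Pi.sub_apply]
    rw [Real.sinc_of_ne_zero this, Real.log_div hs'.ne' this]
  · have h2 : Real.sin θ = 2 * Real.sin (θ / 2) * Real.cos (θ / 2) := by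
      rw [← Real.sin_two_mul]; congr 1; ring
    have h3 := Real.sin_sq_add_cos_sq (θ / 2)
    rw [h2]
    field_simp
    linear_combination θ * h3

theorem intervalIntegrable_inv_sin_sub_inv_and_integral_eq :
    IntervalIntegrable (fun θ : ℝ => 1 / Real.sin θ - 1 / θ) MeasureTheory.volume 0
        (Real.pi / 2) ∧
      ∫ θ in (0 : ℝ)..Real.pi / 2, (1 / Real.sin θ - 1 / θ) = Real.log (4 / Real.pi) := by
  have hpi := Real.pi_pos
  have hle : (0 : ℝ) ≤ Real.pi / 2 := by positivity
  have hcont : ContinuousOn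
      (fun s => Real.log (Real.sinc (s / 2)) - Real.log (Real.cos (s / 2)))
      (Set.Icc 0 (Real.pi / 2)) := by
    refine ContinuousOn.sub (ContinuousOn.log ?_ ?_) (ContinuousOn.log ?_ ?_)
    · exact (Real.continuous_sinc.comp (by fun_prop)).continuousOn
    · intro s hs
      by_cases h0 : s / 2 = 0
      · simp [h0]
      · have hs0 : 0 < s / 2 := lt_of_le_of_ne (by linarith [hs.1]) (Ne.symm h0)
        rw [Real.sinc_of_ne_zero h0]
        exact (div_pos (Real.sin_pos_of_pos_of_lt_pi hs0 (by linarith [hs.2])) hs0).ne'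
    · fun_prop
    · exact fun s hs => (Real.cos_pos_of_mem_Ioo ⟨by linarith [hs.1], by linarith [hs.2]⟩).ne'
  have hint : IntervalIntegrable (fun θ : ℝ => 1 / Real.sin θ - 1 / θ) MeasureTheory.volume 0
      (Real.pi / 2) := by
    rw [intervalIntegrable_iff_integrableOn_Ioc_of_le hle]
    -- Since `sin θ < θ`, the integrand is a nonnegative derivative of a function continuous up to
    -- the endpoints, hence integrable.
    refine intervalIntegral.integrableOn_deriv_of_nonneg hcont
      (fun θ hθ => hasDerivAt_log_sinc_half_sub_log_cos_half hθ) fun θ hθ => ?_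
    have hs := Real.sin_pos_of_pos_of_lt_pi hθ.1 (by linarith [hθ.2])
    exact sub_nonneg.2 (one_div_le_one_div_of_le hs (Real.sin_lt hθ.1).le)
  refine ⟨hint, ?_⟩
  rw [intervalIntegral.integral_eq_sub_of_hasDerivAt_of_le hle hcont
    (fun θ hθ => hasDerivAt_log_sinc_half_sub_log_cos_half hθ) hint]
  have h4 : Real.pi / 2 / 2 = Real.pi / 4 := by ring
  rw [h4, Real.sinc_of_ne_zero (by positivity), Real.sin_pi_div_four, Real.cos_pi_div_four,
    ← Real.log_div (by positivity) (by positivity)]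
  simp only [zero_div, Real.sinc_zero, Real.cos_zero, Real.log_one, sub_zero]
  congr 1
  field_simp

theorem one_sub_cos_two_mul_nat_mul_div_sin (m : ℕ) (θ : ℝ) (hθ : Real.sin θ ≠ 0) :
    (1 - Real.cos (2 * m * θ)) / Real.sin θ =
      ∑ j ∈ Finset.range m, 2 * Real.sin ((2 * j + 1) * θ) := by
  induction m with
  | zero => simp
  | succ n ih =>
    rw [Finset.sum_range_succ, ← ih, div_eq_iff hθ, add_mul, div_mul_cancel₀ _ hθ]
    have h1 := Real.cos_sub_cos (2 * n * θ) (2 * (n + 1 : ℕ) * θ)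
    have h2 : (2 * n * θ + 2 * (n + 1 : ℕ) * θ) / 2 = (2 * n + 1) * θ := by push_cast; ring
    have h3 : (2 * n * θ - 2 * (n + 1 : ℕ) * θ) / 2 = -θ := by push_cast; ring
    rw [h2, h3, Real.sin_neg] at h1
    linarith

theorem integral_sin_two_mul_nat_add_one_mul (j : ℕ) :
    ∫ θ in (0 : ℝ)..Real.pi / 2, Real.sin ((2 * j + 1) * θ) = 1 / (2 * j + 1) := by
  have h : (2 * j + 1 : ℝ) ≠ 0 := by positivity
  rw [intervalIntegral.integral_comp_mul_left (fun x => Real.sin x) h, integral_sin]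
  have : (2 * j + 1) * (Real.pi / 2) = j * Real.pi + Real.pi / 2 := by ring
  rw [this, Real.cos_add_pi_div_two, Real.sin_nat_mul_pi]
  simp

theorem sum_range_two_div_odd (m : ℕ) :
    ∑ j ∈ Finset.range m, 2 * (1 / (2 * (j : ℝ) + 1)) =
      2 * (harmonic (2 * m) : ℝ) - (harmonic m : ℝ) := by
  induction m with
  | zero => simp
  | succ n ih =>
    rw [Finset.sum_range_succ, ih, show 2 * (n + 1) = 2 * n + 1 + 1 by ring, harmonic_succ,
      harmonic_succ, harmonic_succ]
    push_cast
    field_simp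
    ring

/-- The logarithms combine as `2 log (2m) - log m = log (4m)`, and `2γ - γ = γ`. -/
theorem tendsto_two_mul_harmonic_two_mul_sub_harmonic :
    Tendsto (fun m : ℕ => 2 * (harmonic (2 * m) : ℝ) - (harmonic m : ℝ) - Real.log (4 * m)) atTop
      (𝓝 Real.eulerMascheroniConstant) := by
  have h1 := Real.tendsto_harmonic_sub_log
  have h2 := h1.comp (tendsto_id.const_mul_atTop' (r := 2) two_pos)
  have h3 := (h2.const_mul 2).sub h1
  rw [show 2 * Real.eulerMascheroniConstant - Real.eulerMascheroniConstant =
    Real.eulerMascheroniConstant by ring] at h3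
  refine h3.congr' ?_
  filter_upwards [eventually_gt_atTop 0] with m hm
  have hm' : (m : ℝ) ≠ 0 := by positivity
  simp only [Function.comp_apply, id]
  push_cast
  rw [show (4 * m : ℝ) = 2 * (2 * m) by ring, Real.log_mul two_ne_zero hm',
    Real.log_mul two_ne_zero (mul_ne_zero two_ne_zero hm'), Real.log_mul two_ne_zero hm']
  ring

/-- The asymptotic expansion of the entire cosine integral along multiples of `π`. -/
theorem tendsto_integral_one_sub_cos_div_sub_log :
    Tendsto (fun m : ℕ =>
      (∫ θ in (0 : ℝ)..Real.pi / 2, (1 - Real.cos (2 * m * θ)) / θ) - Real.log (Real.pi * m))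
      atTop (𝓝 Real.eulerMascheroniConstant) := by
  have hpi := Real.pi_pos
  have hle : (0 : ℝ) ≤ Real.pi / 2 := by positivity
  obtain ⟨hint, hval⟩ := intervalIntegrable_inv_sin_sub_inv_and_integral_eq
  set K : ℝ → ℝ := fun θ => 1 / Real.sin θ - 1 / θ
  have hKcos : ∀ m : ℕ, IntervalIntegrable (fun θ => K θ * Real.cos (2 * m * θ))
      MeasureTheory.volume 0 (Real.pi / 2) := fun m =>
    hint.mul_continuousOn (by fun_prop)
  have hRL : Tendsto (fun m : ℕ => ∫ θ in (0 : ℝ)..Real.pi / 2, K θ * Real.cos (2 * m * θ))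
      atTop (𝓝 0) := by
    have h := tendsto_intervalIntegral_mul_cexp_cocompact (fun θ => (K θ : ℂ)) hle 0
    have hw : Tendsto (fun m : ℕ => (m : ℝ) / Real.pi) atTop (cocompact ℝ) :=
      (tendsto_natCast_atTop_atTop.atTop_div_const hpi).mono_right atTop_le_cocompact
    have h' := (Complex.continuous_re.tendsto 0).comp (h.comp hw)
    rw [Complex.zero_re] at h'
    refine h'.congr fun m => ?_
    simp only [Function.comp_apply]
    rw [← RCLike.re_eq_complex_re, ← intervalIntegral.intervalIntegral_re]
    · refine intervalIntegral.integral_congr fun θ _ => ?_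
      have hpi' : (Real.pi : ℂ) ≠ 0 := by exact_mod_cast hpi.ne'
      have : (2 * Real.pi * Complex.I * ((m : ℝ) / Real.pi : ℝ) * ((0 : ℝ) - θ) : ℂ) =
          ((-(2 * m * θ) : ℝ) : ℂ) * Complex.I := by
        push_cast
        field_simp
        ring
      simp only [this, RCLike.re_eq_complex_re, Complex.re_ofReal_mul, Complex.exp_ofReal_mul_I_re,
        Real.cos_neg]
    · have : IntervalIntegrable (fun θ => (K θ : ℂ)) MeasureTheory.volume 0 (Real.pi / 2) :=
        ⟨hint.1.ofReal, hint.2.ofReal⟩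
      exact this.mul_continuousOn (by fun_prop)
  -- Replace `1/θ` by `1/sin θ - K θ`: the first part is a finite sine sum, the constant part of `K`
  -- integrates to `log (4/π)`, and the oscillating part tends to 0.
  have hmain : ∀ m : ℕ, ∫ θ in (0 : ℝ)..Real.pi / 2, (1 - Real.cos (2 * m * θ)) / θ =
      (2 * (harmonic (2 * m) : ℝ) - (harmonic m : ℝ)) - Real.log (4 / Real.pi) +
        ∫ θ in (0 : ℝ)..Real.pi / 2, K θ * Real.cos (2 * m * θ) := by
    intro m
    have hs : ∫ θ in (0 : ℝ)..Real.pi / 2,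
        ∑ j ∈ Finset.range m, 2 * Real.sin ((2 * j + 1) * θ) =
        2 * (harmonic (2 * m) : ℝ) - (harmonic m : ℝ) := by
      rw [intervalIntegral.integral_finsetSum
        (fun j _ => Continuous.intervalIntegrable (by fun_prop) _ _), ← sum_range_two_div_odd]
      refine Finset.sum_congr rfl fun j _ => ?_
      rw [intervalIntegral.integral_const_mul, integral_sin_two_mul_nat_add_one_mul]
    rw [← hs, ← hval, ← intervalIntegral.integral_sub
      (Continuous.intervalIntegrable (by fun_prop) _ _) hint, ← intervalIntegral.integral_add
      ((Continuous.intervalIntegrable (by fun_prop) _ _).sub hint) (hKcos m)]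
    refine intervalIntegral.integral_congr_ae (Eventually.of_forall fun θ hθ => ?_)
    rw [Set.uIoc_of_le hle] at hθ
    have hsin := Real.sin_pos_of_pos_of_lt_pi hθ.1 (by linarith [hθ.2])
    rw [← one_sub_cos_two_mul_nat_mul_div_sin m θ hsin.ne']
    simp only [K]
    ring
  have h := (tendsto_two_mul_harmonic_two_mul_sub_harmonic.add hRL)
  rw [add_zero] at h
  refine h.congr' ?_
  filter_upwards [eventually_gt_atTop 0] with m hm
  have hm' : (m : ℝ) ≠ 0 := by positivity
  rw [hmain, Real.log_mul (by norm_num) hm', Real.log_mul hpi.ne' hm',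
    Real.log_div (by norm_num) hpi.ne']
  ring

/-- Rescaling by `u = 2nθ/π` turns this into the previous limit along the subsequence `m = 2kn`. -/
theorem tendsto_integral_one_sub_cos_two_pi_div_sub_log {k : ℕ} (hk : k ≠ 0) :
    Tendsto (fun n : ℕ =>
      (∫ u in (0 : ℝ)..n, (1 - Real.cos (2 * Real.pi * k * u)) / u) - Real.log n)
      atTop (𝓝 (Real.eulerMascheroniConstant + Real.log (2 * Real.pi * k))) := by
  have hpi := Real.pi_pos
  have hk' : (0 : ℝ) < k := by positivity
  have h := (tendsto_integral_one_sub_cos_div_sub_log.comp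
    (tendsto_id.const_mul_atTop' (r := 2 * k) (by positivity))).add_const
    (Real.log (2 * Real.pi * k))
  refine h.congr' ?_
  filter_upwards [eventually_gt_atTop 0] with n hn
  have hn' : (0 : ℝ) < n := by positivity
  have hc : (2 * n / Real.pi : ℝ) ≠ 0 := by positivity
  have hsub := intervalIntegral.integral_comp_mul_left (a := 0) (b := Real.pi / 2)
    (fun u : ℝ => (1 - Real.cos (2 * Real.pi * k * u)) / u) hc
  rw [mul_zero, show 2 * n / Real.pi * (Real.pi / 2) = (n : ℝ) by field_simp, smul_eq_mul,
    eq_inv_mul_iff_mul_eq₀ hc, ← intervalIntegral.integral_const_mul] at hsub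
  simp only [Function.comp_apply, id]
  rw [← hsub]
  have h1 : Real.log (Real.pi * ((2 * k * n : ℕ) : ℝ)) =
      Real.log (2 * Real.pi * k) + Real.log n := by
    rw [← Real.log_mul (by positivity) hn'.ne']
    congr 1
    push_cast
    ring
  rw [h1]
  have h2 : ∀ θ : ℝ, (1 - Real.cos (2 * ((2 * k * n : ℕ) : ℝ) * θ)) / θ = 2 * n / Real.pi *
      ((1 - Real.cos (2 * Real.pi * k * (2 * n / Real.pi * θ))) / (2 * n / Real.pi * θ)) := by
    intro θ
    have : 2 * Real.pi * k * (2 * n / Real.pi * θ) = 2 * ((2 * k * n : ℕ) : ℝ) * θ := by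
      push_cast
      field_simp
    rw [this, mul_div_assoc', mul_div_mul_left _ _ hc]
  simp_rw [h2]
  ring

/-! ### Sine coefficients of `log Γ` -/

/-- Integration by parts, with `1 - cos` rather than `-cos` as primitive of the sine (up to a
factor): the boundary terms then vanish at both ends. -/
theorem integral_log_mul_sin_two_pi (k n : ℕ) (hk : k ≠ 0) :
    ∫ u in (0 : ℝ)..n, Real.log u * Real.sin (2 * Real.pi * k * u) =
      -(1 / (2 * Real.pi * k)) * ∫ u in (0 : ℝ)..n, (1 - Real.cos (2 * Real.pi * k * u)) / u := by
  have hpi := Real.pi_pos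
  have hk' : (0 : ℝ) < k := by positivity
  set a : ℝ := 2 * Real.pi * k with ha
  have ha0 : a ≠ 0 := by positivity
  have hlogsin : IntervalIntegrable (fun u => Real.log u * Real.sin (a * u))
      MeasureTheory.volume 0 n :=
    intervalIntegral.intervalIntegrable_log'.mul_continuousOn (by fun_prop)
  have hcos := (continuous_one_sub_cos_div a).intervalIntegrable (μ := MeasureTheory.volume) 0 n
  -- Both factors on the left are continuous at 0, which gives continuity of the boundary term
  -- there.
  have hF : ∀ u : ℝ, u * Real.log u * ((1 - Real.cos (a * u)) / u) =
      Real.log u * (1 - Real.cos (a * u)) := by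
    intro u
    by_cases hu : u = 0
    · simp [hu]
    · field_simp
  have hcont : Continuous fun u => Real.log u * (1 - Real.cos (a * u)) := by
    simp_rw [← hF]
    exact Real.continuous_mul_log.mul (continuous_one_sub_cos_div a)
  have hderiv : ∀ u ∈ Set.Ioo (0 : ℝ) n, HasDerivAt (fun u => Real.log u * (1 - Real.cos (a * u)))
      ((1 - Real.cos (a * u)) / u + a * (Real.log u * Real.sin (a * u))) u := by
    intro u hu
    have h1 := (((hasDerivAt_id u).const_mul a).cos).const_sub 1
    refine ((Real.hasDerivAt_log hu.1.ne').mul h1).congr_deriv ?_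
    simp only [id]
    ring
  have h := intervalIntegral.integral_eq_sub_of_hasDerivAt_of_le (Nat.cast_nonneg n)
    hcont.continuousOn hderiv (hcos.add (hlogsin.const_mul a))
  have hend : Real.cos (a * n) = 1 := by
    rw [ha, show 2 * Real.pi * k * n = ((k * n : ℕ) : ℝ) * (2 * Real.pi) by push_cast; ring]
    exact Real.cos_nat_mul_two_pi _
  rw [intervalIntegral.integral_add hcos (hlogsin.const_mul a),
    intervalIntegral.integral_const_mul, hend] at h
  simp only [sub_self, mul_zero, Real.cos_zero] at h
  field_simp
  linarith

theorem differentiableAt_Gamma_of_pos {t : ℝ} (ht : 0 < t) : DifferentiableAt ℝ Real.Gamma t :=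
  Real.differentiableAt_Gamma fun m => by
    have : (0 : ℝ) ≤ m := Nat.cast_nonneg m
    linarith

theorem intervalIntegrable_log_Gamma :
    IntervalIntegrable (fun t => Real.log (Real.Gamma t)) MeasureTheory.volume 0 1 := by
  -- The functional equation isolates the singularity at 0 as `-log t`.
  have hc : ContinuousOn (fun t : ℝ => Real.log (Real.Gamma (t + 1))) (Set.uIcc 0 1) := by
    rw [Set.uIcc_of_le zero_le_one]
    intro t ht
    have ht' : 0 < t + 1 := by linarith [ht.1]
    have h1 : ContinuousAt (fun t : ℝ => Real.Gamma (t + 1)) t :=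
      ContinuousAt.comp' (differentiableAt_Gamma_of_pos ht').continuousAt (by fun_prop)
    exact (h1.log (Real.Gamma_pos_of_pos ht').ne').continuousWithinAt
  refine (hc.intervalIntegrable.sub intervalIntegral.intervalIntegrable_log').congr ?_
  intro t ht
  rw [Set.uIoc_of_le zero_le_one] at ht
  simp only
  rw [Real.Gamma_add_one ht.1.ne', Real.log_mul ht.1.ne' (Real.Gamma_pos_of_pos ht.1).ne']
  ring

/-- Log-convexity of `Γ` gives the Bohr-Mollerup bounds. The bound does not depend on `t`, so limits
pass under the integral. -/
theorem abs_log_Gamma_sub_logGammaSeq_le {t : ℝ} (ht : t ∈ Set.Ioc (0 : ℝ) 1) {n : ℕ}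
    (hn : n ≠ 0) :
    |Real.log (Real.Gamma t) - Real.BohrMollerup.logGammaSeq t n| ≤
      Real.log (n + 1) - Real.log n := by
  have hfeq : ∀ {y : ℝ}, 0 < y →
      (Real.log ∘ Real.Gamma) (y + 1) = (Real.log ∘ Real.Gamma) y + Real.log y := by
    intro y hy
    simp only [Function.comp_apply]
    rw [Real.Gamma_add_one hy.ne', Real.log_mul hy.ne' (Real.Gamma_pos_of_pos hy).ne', add_comm]
  have h1 := Real.BohrMollerup.le_logGammaSeq Real.convexOn_log_Gamma hfeq ht.1 ht.2 n
  have h2 := Real.BohrMollerup.ge_logGammaSeq Real.convexOn_log_Gamma hfeq ht.1 hn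
  simp only [Function.comp_apply, Real.Gamma_one, Real.log_one, zero_add] at h1 h2
  have hn' : (0 : ℝ) < n := by positivity
  have h3 : 0 ≤ Real.log (n + 1) - Real.log n :=
    sub_nonneg.2 (Real.log_le_log hn' (by linarith))
  rw [abs_le]
  constructor
  · linarith
  · nlinarith [mul_le_mul_of_nonneg_right ht.2 h3]

theorem integral_sin_two_pi {k : ℕ} (hk : k ≠ 0) :
    ∫ t in (0 : ℝ)..1, Real.sin (2 * Real.pi * k * t) = 0 := by
  have hc : (2 * Real.pi * k : ℝ) ≠ 0 := by positivity
  rw [intervalIntegral.integral_comp_mul_left (fun x => Real.sin x) hc, integral_sin, mul_one,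
    show 2 * Real.pi * k = (k : ℝ) * (2 * Real.pi) by ring, Real.cos_nat_mul_two_pi]
  simp

theorem integral_mul_sin_two_pi {k : ℕ} (hk : k ≠ 0) :
    ∫ t in (0 : ℝ)..1, t * Real.sin (2 * Real.pi * k * t) = -(1 / (2 * Real.pi * k)) := by
  set a : ℝ := 2 * Real.pi * k with ha
  have ha0 : a ≠ 0 := by positivity
  have hcos : Real.cos a = 1 := by
    rw [ha, show 2 * Real.pi * k = (k : ℝ) * (2 * Real.pi) by ring, Real.cos_nat_mul_two_pi]
  have hsin : Real.sin a = 0 := by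
    rw [ha, show 2 * Real.pi * k = ((2 * k : ℕ) : ℝ) * Real.pi by push_cast; ring,
      Real.sin_nat_mul_pi]
  have hd : ∀ t ∈ Set.uIcc (0 : ℝ) 1, HasDerivAt
      (fun t => Real.sin (a * t) / a ^ 2 - t * (Real.cos (a * t) / a))
      (t * Real.sin (a * t)) t := by
    intro t _
    have h1 := (hasDerivAt_id t).const_mul a
    refine ((h1.sin.div_const (a ^ 2)).sub
      ((hasDerivAt_id t).mul (h1.cos.div_const a))).congr_deriv ?_
    simp only [id]
    field_simp
    ring
  rw [intervalIntegral.integral_eq_sub_of_hasDerivAt hd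
    (Continuous.intervalIntegrable (by fun_prop) _ _)]
  simp [hcos, hsin]

/-- By periodicity of the sine, the terms `log (t + m)` for `m ≤ n` tile a single integral of `log
u` over `[0,n+1]`. The term `t log n` yields `-log n`, and the factorial term integrates to 0. -/
theorem integral_logGammaSeq_mul_sin {k : ℕ} (hk : k ≠ 0) (n : ℕ) :
    ∫ t in (0 : ℝ)..1, Real.BohrMollerup.logGammaSeq t n * Real.sin (2 * Real.pi * k * t) =
      1 / (2 * Real.pi * k) *
        ((∫ u in (0 : ℝ)..(n + 1 : ℕ), (1 - Real.cos (2 * Real.pi * k * u)) / u) -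
          Real.log n) := by
  have hlog : ∀ m : ℕ, IntervalIntegrable
      (fun u => Real.log u * Real.sin (2 * Real.pi * k * u)) MeasureTheory.volume m (m + 1 : ℕ) :=
    fun m => intervalIntegral.intervalIntegrable_log'.mul_continuousOn (by fun_prop)
  have hshift : ∀ (m : ℕ) (t : ℝ), Real.log (t + m) * Real.sin (2 * Real.pi * k * t) =
      Real.log (t + m) * Real.sin (2 * Real.pi * k * (t + m)) := by
    intro m t
    rw [show 2 * Real.pi * k * (t + m) =
      2 * Real.pi * k * t + ((k * m : ℕ) : ℝ) * (2 * Real.pi) by push_cast; ring,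
      Real.sin_add_nat_mul_two_pi]
  have hterm : ∀ m : ℕ,
      ∫ t in (0 : ℝ)..1, Real.log (t + m) * Real.sin (2 * Real.pi * k * t) =
      ∫ u in (m : ℝ)..(m + 1 : ℕ), Real.log u * Real.sin (2 * Real.pi * k * u) := by
    intro m
    simp_rw [hshift]
    rw [intervalIntegral.integral_comp_add_right
      (fun u => Real.log u * Real.sin (2 * Real.pi * k * u)) (m : ℝ)]
    congr 1
    · simp
    · push_cast; ring
  have hterm_int : ∀ m : ℕ, IntervalIntegrable
      (fun t : ℝ => Real.log (t + m) * Real.sin (2 * Real.pi * k * t))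
      MeasureTheory.volume 0 1 := by
    intro m
    have := (hlog m).comp_add_right (m : ℝ)
    simp_rw [hshift]
    convert this using 1
    · simp
    · push_cast; ring
  have hsum : ∫ t in (0 : ℝ)..1,
      ∑ m ∈ Finset.range (n + 1), Real.log (t + m) * Real.sin (2 * Real.pi * k * t) =
      -(1 / (2 * Real.pi * k)) *
        ∫ u in (0 : ℝ)..(n + 1 : ℕ), (1 - Real.cos (2 * Real.pi * k * u)) / u := by
    rw [intervalIntegral.integral_finsetSum (fun m _ => hterm_int m)]
    simp_rw [hterm]
    rw [intervalIntegral.sum_integral_adjacent_intervals (a := fun m : ℕ => (m : ℝ))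
      (fun m _ => hlog m), Nat.cast_zero, integral_log_mul_sin_two_pi k (n + 1) hk]
  have h1 : ∀ t : ℝ,
      Real.BohrMollerup.logGammaSeq t n * Real.sin (2 * Real.pi * k * t) =
      Real.log n * (t * Real.sin (2 * Real.pi * k * t)) +
        Real.log n.factorial * Real.sin (2 * Real.pi * k * t) -
        ∑ m ∈ Finset.range (n + 1), Real.log (t + m) * Real.sin (2 * Real.pi * k * t) := by
    intro t
    rw [Real.BohrMollerup.logGammaSeq, ← Finset.sum_mul]
    ring
  have hi1 : IntervalIntegrable (fun t : ℝ => Real.log n * (t * Real.sin (2 * Real.pi * k * t)))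
      MeasureTheory.volume 0 1 := Continuous.intervalIntegrable (by fun_prop) _ _
  have hi2 : IntervalIntegrable
      (fun t : ℝ => Real.log n.factorial * Real.sin (2 * Real.pi * k * t))
      MeasureTheory.volume 0 1 := Continuous.intervalIntegrable (by fun_prop) _ _
  have hi3 : IntervalIntegrable (fun t : ℝ => ∑ m ∈ Finset.range (n + 1),
      Real.log (t + m) * Real.sin (2 * Real.pi * k * t)) MeasureTheory.volume 0 1 := by
    have := IntervalIntegrable.sum (Finset.range (n + 1)) (fun m _ => hterm_int m)
    simpa [Finset.sum_fn] using this
  simp_rw [h1]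
  rw [intervalIntegral.integral_sub (hi1.add hi2) hi3, intervalIntegral.integral_add hi1 hi2, hsum,
    intervalIntegral.integral_const_mul, intervalIntegral.integral_const_mul,
    integral_sin_two_pi hk, integral_mul_sin_two_pi hk]
  ring

/-- The Fourier sine coefficients of `log Γ` on the unit interval. -/
theorem integral_log_Gamma_mul_sin {k : ℕ} (hk : k ≠ 0) :
    ∫ t in (0 : ℝ)..1, Real.log (Real.Gamma t) * Real.sin (2 * Real.pi * k * t) =
      1 / (2 * Real.pi * k) * (Real.eulerMascheroniConstant + Real.log (2 * Real.pi * k)) := by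
  have hloglim : Tendsto (fun n : ℕ => Real.log (n + 1) - Real.log n) atTop (𝓝 0) :=
    Real.tendsto_log_nat_add_one_sub_log
  have hlim1 : Tendsto (fun n : ℕ => ∫ t in (0 : ℝ)..1,
      Real.BohrMollerup.logGammaSeq t n * Real.sin (2 * Real.pi * k * t)) atTop
      (𝓝 (1 / (2 * Real.pi * k) *
        (Real.eulerMascheroniConstant + Real.log (2 * Real.pi * k)))) := by
    -- The integral runs to `n+1` but only `log n` is subtracted; `hloglim` absorbs the difference.
    have h := ((tendsto_integral_one_sub_cos_two_pi_div_sub_log hk).comp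
      (tendsto_add_atTop_nat 1)).add hloglim
    rw [add_zero] at h
    refine (h.const_mul (1 / (2 * Real.pi * k))).congr fun n => ?_
    rw [integral_logGammaSeq_mul_sin hk]
    simp only [Function.comp_apply]
    push_cast
    ring
  have hG : IntervalIntegrable
      (fun t => Real.log (Real.Gamma t) * Real.sin (2 * Real.pi * k * t))
      MeasureTheory.volume 0 1 :=
    intervalIntegrable_log_Gamma.mul_continuousOn (by fun_prop)
  have hS : ∀ n : ℕ, IntervalIntegrable
      (fun t => Real.BohrMollerup.logGammaSeq t n * Real.sin (2 * Real.pi * k * t))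
      MeasureTheory.volume 0 1 := by
    intro n
    refine IntervalIntegrable.mul_continuousOn ?_ (by fun_prop)
    have h1 : IntervalIntegrable (fun t : ℝ => t * Real.log n + Real.log n.factorial)
        MeasureTheory.volume 0 1 := Continuous.intervalIntegrable (by fun_prop) _ _
    have h2 : ∀ m : ℕ, IntervalIntegrable (fun t : ℝ => Real.log (t + m))
        MeasureTheory.volume 0 1 := by
      intro m
      have := (intervalIntegral.intervalIntegrable_log' (a := m) (b := m + 1)).comp_add_right
        (m : ℝ)
      simpa using this
    have h3 := IntervalIntegrable.sum (Finset.range (n + 1)) (fun m _ => h2 m)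
    have h4 := h1.sub h3
    refine h4.congr fun t _ => ?_
    simp [Real.BohrMollerup.logGammaSeq]
  have hlim2 : Tendsto (fun n : ℕ => ∫ t in (0 : ℝ)..1,
      Real.BohrMollerup.logGammaSeq t n * Real.sin (2 * Real.pi * k * t)) atTop
      (𝓝 (∫ t in (0 : ℝ)..1, Real.log (Real.Gamma t) * Real.sin (2 * Real.pi * k * t))) := by
    rw [tendsto_iff_norm_sub_tendsto_zero]
    refine squeeze_zero' (Eventually.of_forall fun n => norm_nonneg _) ?_ hloglim
    filter_upwards [eventually_ne_atTop 0] with n hn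
    rw [← intervalIntegral.integral_sub (hS n) hG]
    have h := intervalIntegral.norm_integral_le_of_norm_le_const (a := 0) (b := 1)
      (C := Real.log (n + 1) - Real.log n)
      (f := fun t => Real.BohrMollerup.logGammaSeq t n * Real.sin (2 * Real.pi * k * t) -
        Real.log (Real.Gamma t) * Real.sin (2 * Real.pi * k * t)) ?_
    · simpa using h
    · intro t ht
      rw [Set.uIoc_of_le zero_le_one] at ht
      rw [← sub_mul, norm_mul, Real.norm_eq_abs, Real.norm_eq_abs, abs_sub_comm]
      have h1 := abs_log_Gamma_sub_logGammaSeq_le ht hn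
      exact (mul_le_of_le_one_right (abs_nonneg _) (Real.abs_sin_le_one _)).trans h1
  exact tendsto_nhds_unique hlim2 hlim1

/-! ### Antisymmetric functions and Kummer's series -/

/-- The sine series on the unit interval of an integrable function which is antisymmetric about
`1/2` converges to the function at every point of differentiability. -/
theorem tendsto_sine_series_of_antisymm {f : ℝ → ℝ} {x : ℝ}
    (hf : IntervalIntegrable f MeasureTheory.volume 0 1) (hx : x ∈ Set.Ioo (0 : ℝ) 1)
    (hd : DifferentiableAt ℝ f x) (hanti : ∀ t, f (1 - t) = -f t) :
    Tendsto (fun N : ℕ => ∑ k ∈ Finset.Icc 1 N,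
      2 * (∫ t in (0 : ℝ)..1, f t * Real.sin (2 * Real.pi * k * t)) *
        Real.sin (2 * Real.pi * k * x)) atTop (𝓝 (f x)) := by
  have hfc : IntervalIntegrable (fun t => (f t : ℂ)) MeasureTheory.volume 0 1 :=
    ⟨hf.1.ofReal, hf.2.ofReal⟩
  have hdc : DifferentiableAt ℝ (fun t => (f t : ℂ)) x :=
    hd.hasDerivAt.ofReal_comp.differentiableAt
  have hcos : ∀ k : ℕ, ∫ t in (0 : ℝ)..1, f t * Real.cos (2 * Real.pi * k * t) = 0 := by
    intro k
    have h := intervalIntegral.integral_comp_sub_left (a := 0) (b := 1)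
      (fun t => f t * Real.cos (2 * Real.pi * k * t)) 1
    have h1 : ∀ t : ℝ, f (1 - t) * Real.cos (2 * Real.pi * k * (1 - t)) =
        -(f t * Real.cos (2 * Real.pi * k * t)) := by
      intro t
      rw [hanti, show 2 * Real.pi * k * (1 - t) =
        (k : ℝ) * (2 * Real.pi) - 2 * Real.pi * k * t by ring, Real.cos_nat_mul_two_pi_sub]
      ring
    simp_rw [h1] at h
    rw [intervalIntegral.integral_neg, sub_self, sub_zero] at h
    linarith
  have hfcos : ∀ k : ℕ, IntervalIntegrable (fun t => f t * Real.cos (2 * Real.pi * k * t))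
      MeasureTheory.volume 0 1 := fun k => hf.mul_continuousOn (by fun_prop)
  have hfsin : ∀ k : ℕ, IntervalIntegrable (fun t => f t * Real.sin (2 * Real.pi * k * t))
      MeasureTheory.volume 0 1 := fun k => hf.mul_continuousOn (by fun_prop)
  have hzero : ∫ t in (0 : ℝ)..1, f t = 0 := by simpa using hcos 0
  have hterm : ∀ k : ℕ,
      (∫ t in (0 : ℝ)..1, (f t : ℂ) * Complex.exp (2 * Real.pi * Complex.I * (k : ℝ) * (x - t))) +
        (∫ t in (0 : ℝ)..1,
          (f t : ℂ) * Complex.exp (2 * Real.pi * Complex.I * (-k : ℝ) * (x - t))) =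
      ((2 * (∫ t in (0 : ℝ)..1, f t * Real.sin (2 * Real.pi * k * t)) *
        Real.sin (2 * Real.pi * k * x) : ℝ) : ℂ) := by
    intro k
    rw [← intervalIntegral.integral_add (hfc.mul_continuousOn (by fun_prop))
      (hfc.mul_continuousOn (by fun_prop))]
    have h1 : ∀ t : ℝ,
        (f t : ℂ) * Complex.exp (2 * Real.pi * Complex.I * (k : ℝ) * (x - t)) +
          (f t : ℂ) * Complex.exp (2 * Real.pi * Complex.I * (-k : ℝ) * (x - t)) =
        ((2 * Real.cos (2 * Real.pi * k * x) * (f t * Real.cos (2 * Real.pi * k * t)) +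
          2 * Real.sin (2 * Real.pi * k * x) * (f t * Real.sin (2 * Real.pi * k * t)) : ℝ) :
          ℂ) := by
      intro t
      have h2 : (2 * Real.pi * Complex.I * (k : ℝ) * (x - t) : ℂ) =
          (2 * Real.pi * k * x - 2 * Real.pi * k * t : ℂ) * Complex.I := by push_cast; ring
      have h3 : (2 * Real.pi * Complex.I * (-k : ℝ) * (x - t) : ℂ) =
          -(2 * Real.pi * k * x - 2 * Real.pi * k * t : ℂ) * Complex.I := by push_cast; ring
      rw [h2, h3, ← mul_add, ← Complex.two_cos, Complex.cos_sub]
      push_cast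
      ring
    simp_rw [h1]
    rw [intervalIntegral.integral_ofReal, intervalIntegral.integral_add
      ((hfcos k).const_mul _) ((hfsin k).const_mul _), intervalIntegral.integral_const_mul,
      intervalIntegral.integral_const_mul, hcos k]
    congr 1
    ring
  have h := (Complex.continuous_re.tendsto _).comp (tendsto_fourier_partial_sum hfc hx hdc)
  refine h.congr fun N => ?_
  simp only [Function.comp_apply]
  simp_rw [hterm]
  rw [intervalIntegral.integral_ofReal, hzero, ← Complex.ofReal_sum, ← Complex.ofReal_add,
    Complex.ofReal_re, zero_add]

theorem intervalIntegrable_log_Gamma_one_sub :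
    IntervalIntegrable (fun t => Real.log (Real.Gamma (1 - t))) MeasureTheory.volume 0 1 := by
  simpa using (intervalIntegrable_log_Gamma.comp_sub_left 1).symm

/-- The reflection `t ↦ 1 - t` negates the sine, so the two Gamma terms contribute equally; the
linear term contributes `-c/(πk)`. -/
theorem integral_log_Gamma_sub_add_linear_mul_sin {k : ℕ} (hk : k ≠ 0) (c : ℝ) :
    ∫ t in (0 : ℝ)..1, (Real.log (Real.Gamma t) - Real.log (Real.Gamma (1 - t)) +
        (2 * t - 1) * c) * Real.sin (2 * Real.pi * k * t) =
      1 / (Real.pi * k) *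
        (Real.eulerMascheroniConstant + Real.log (2 * Real.pi * k) - c) := by
  have hpi := Real.pi_pos
  have hrefl : ∫ t in (0 : ℝ)..1,
      Real.log (Real.Gamma (1 - t)) * Real.sin (2 * Real.pi * k * t) =
      -∫ t in (0 : ℝ)..1, Real.log (Real.Gamma t) * Real.sin (2 * Real.pi * k * t) := by
    have h := intervalIntegral.integral_comp_sub_left (a := 0) (b := 1)
      (fun t => Real.log (Real.Gamma t) * Real.sin (2 * Real.pi * k * t)) 1
    have h1 : ∀ t : ℝ, Real.log (Real.Gamma (1 - t)) * Real.sin (2 * Real.pi * k * (1 - t)) =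
        -(Real.log (Real.Gamma (1 - t)) * Real.sin (2 * Real.pi * k * t)) := by
      intro t
      rw [show 2 * Real.pi * k * (1 - t) =
        (k : ℝ) * (2 * Real.pi) - 2 * Real.pi * k * t by ring, Real.sin_nat_mul_two_pi_sub]
      ring
    simp_rw [h1] at h
    rw [intervalIntegral.integral_neg, sub_self, sub_zero] at h
    linarith
  have hi1 : IntervalIntegrable (fun t => Real.log (Real.Gamma t) * Real.sin (2 * Real.pi * k * t))
      MeasureTheory.volume 0 1 := intervalIntegrable_log_Gamma.mul_continuousOn (by fun_prop)
  have hi2 : IntervalIntegrable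
      (fun t => Real.log (Real.Gamma (1 - t)) * Real.sin (2 * Real.pi * k * t))
      MeasureTheory.volume 0 1 :=
    intervalIntegrable_log_Gamma_one_sub.mul_continuousOn (by fun_prop)
  have hi3 : IntervalIntegrable (fun t : ℝ => 2 * c * (t * Real.sin (2 * Real.pi * k * t)))
      MeasureTheory.volume 0 1 := Continuous.intervalIntegrable (by fun_prop) _ _
  have hi4 : IntervalIntegrable (fun t : ℝ => c * Real.sin (2 * Real.pi * k * t))
      MeasureTheory.volume 0 1 := Continuous.intervalIntegrable (by fun_prop) _ _
  have h1 : ∀ t : ℝ, (Real.log (Real.Gamma t) - Real.log (Real.Gamma (1 - t)) +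
        (2 * t - 1) * c) * Real.sin (2 * Real.pi * k * t) =
      Real.log (Real.Gamma t) * Real.sin (2 * Real.pi * k * t) -
        Real.log (Real.Gamma (1 - t)) * Real.sin (2 * Real.pi * k * t) +
        (2 * c * (t * Real.sin (2 * Real.pi * k * t)) - c * Real.sin (2 * Real.pi * k * t)) := by
    intro t
    ring
  simp_rw [h1]
  rw [intervalIntegral.integral_add (hi1.sub hi2) (hi3.sub hi4),
    intervalIntegral.integral_sub hi1 hi2, intervalIntegral.integral_sub hi3 hi4, hrefl,
    intervalIntegral.integral_const_mul, intervalIntegral.integral_const_mul,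
    integral_mul_sin_two_pi hk, integral_sin_two_pi hk, integral_log_Gamma_mul_sin hk]
  field_simp
  ring

theorem mainTheorem2 (x : ℝ) (hx : |x| < 1 / 2) :
    ∃ S : ℝ,
      Tendsto (fun N : ℕ => ∑ k ∈ Finset.Icc 1 N,
          (-1 : ℝ) ^ k * (Real.log (k : ℝ) / (k : ℝ)) * Real.sin (2 * (k : ℝ) * Real.pi * x))
        atTop (𝓝 S) ∧
      Real.log (Real.Gamma (1 / 2 + x) / Real.Gamma (1 / 2 - x)) =
        -2 * x * (Real.eulerMascheroniConstant + Real.log (2 * Real.pi)) +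
          (2 / Real.pi) * S := by
  have hpi := Real.pi_pos
  obtain ⟨hx1, hx2⟩ := abs_lt.1 hx
  set c := Real.eulerMascheroniConstant + Real.log (2 * Real.pi) with hc
  set f : ℝ → ℝ := fun t =>
    Real.log (Real.Gamma t) - Real.log (Real.Gamma (1 - t)) + (2 * t - 1) * c with hf_def
  have hp : 0 < 1 / 2 + x := by linarith
  have hq : 0 < 1 / 2 - x := by linarith
  have hq' : 1 - (1 / 2 + x) = 1 / 2 - x := by ring
  have hf : IntervalIntegrable f MeasureTheory.volume 0 1 :=
    (intervalIntegrable_log_Gamma.sub intervalIntegrable_log_Gamma_one_sub).add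
      (Continuous.intervalIntegrable (by fun_prop) _ _)
  have hd : DifferentiableAt ℝ f (1 / 2 + x) := by
    refine DifferentiableAt.add (DifferentiableAt.sub ?_ ?_) (by fun_prop)
    · exact (differentiableAt_Gamma_of_pos hp).log (Real.Gamma_pos_of_pos hp).ne'
    · have h1 : DifferentiableAt ℝ (fun t : ℝ => Real.Gamma (1 - t)) (1 / 2 + x) := by
        have hG : DifferentiableAt ℝ Real.Gamma (1 - (1 / 2 + x)) :=
          hq'.symm ▸ differentiableAt_Gamma_of_pos hq
        exact hG.comp (1 / 2 + x) (differentiableAt_id.const_sub 1)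
      refine h1.log ?_
      rw [hq']
      exact (Real.Gamma_pos_of_pos hq).ne'
  have hanti : ∀ t, f (1 - t) = -f t := by
    intro t
    simp only [hf_def, sub_sub_cancel]
    ring
  have h := tendsto_sine_series_of_antisymm hf ⟨hp, by linarith⟩ hd hanti
  -- The sine series of `f` has coefficients `2 log k / (πk)`, hence the factor `π/2`.
  refine ⟨Real.pi / 2 * f (1 / 2 + x), (h.const_mul (Real.pi / 2)).congr fun N => ?_, ?_⟩
  · rw [Finset.mul_sum]
    refine Finset.sum_congr rfl fun k hk => ?_
    have hk0 : k ≠ 0 := by have := (Finset.mem_Icc.1 hk).1; omega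
    have hk' : (k : ℝ) ≠ 0 := by exact_mod_cast hk0
    have hsin : Real.sin (2 * Real.pi * k * (1 / 2 + x)) =
        (-1) ^ k * Real.sin (2 * k * Real.pi * x) := by
      rw [show 2 * Real.pi * k * (1 / 2 + x) = 2 * k * Real.pi * x + k * Real.pi by ring,
        Real.sin_add_nat_mul_pi]
    rw [integral_log_Gamma_sub_add_linear_mul_sin hk0, hsin, hc,
      Real.log_mul (by positivity) hk']
    field_simp
    ring
  · rw [Real.log_div (Real.Gamma_pos_of_pos hp).ne' (Real.Gamma_pos_of_pos hq).ne']
    simp only [hf_def, hq']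
    field_simp
    ring
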